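/- Let $q$ be a prime power and $1\le n\le m$. An $\mathbb{F}_q$-linear code is an $\mathbb{F}_q$-subspace $\mathcal{C}$ of the space of $n\times m$ matrices over $\mathbb{F}_q$, with $\mathcal{C}$ neither zero nor the whole space. Let $t=\dim_{\mathbb{F}_q}\mathcal{C}$, let $d=\min\{\operatorname{rank}A: 0\ne A\in\mathcal{C}\}$ be its minimum distance, let $A_i=|\{A\in\mathcal{C}:\operatorname{rank}A=i\}|$, and let $\mathcal{C}^\perp=\{B: \operatorname{Tr}(BA^{T})=0\ \forall A\in\mathcal{C}\}$. The rank defect of $\mathcal{C}$ is $\operatorname{rdef}(\mathcal{C})=n-\lceil t/m\rceil+1-d$, and $\mathcal{C}$ is called dually AMRD if $\operatorname{rdef}(\mathcal{C})=\operatorname{rdef}(\mathcal{C}^\perp)=1$. Write ${a\brack b}=\prod_{i=0}^{b-1}\frac{q^a-q^i}{q^b-q^i}$ for the Gaussian binomial coefficient. Let $\mathcal{C}$ be a $t$-dimensional dually AMRD code with minimum distance $d$. Then: 1. If $m\nmid t$ and $t=\beta m+\alpha$ with integers $\beta$ and $1\le\alpha<m$, then for all $r=2,\dots,n-d$ $$A_{d+r}=(-1)^{r-1}q^{\binom{r-1}{2}}\left({n-d-1\brack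 r-1}A_{d+1}+{n-d\brack r}{r-1\brack 1}A_d\right)+{n\brack d+r}\sum_{i=0}^{r-2}(-1)^iq^{\binom i2}{d+r\brack i}\left(q^{\alpha+m(r-1-i)}-1\right).$$ 2. If $m\mid t$, then for all $r=1,\dots,n-d$ $$A_{d+r}=(-1)^rq^{\binom r2}{n-d\brack r}A_d+{n\brack d+r}\sum_{i=0}^{r-1}(-1)^iq^{\binom i2}{d+r\brack i}\left(q^{m(r-i)}-1\right).$$ In particular, let $C\le\mathbb{F}_{q^m}^n$ be an $\mathbb{F}_{q^m}$-subspace of dimension $k$, neither zero nor the whole space, where the rank of a vector is the $\mathbb{F}_q$-dimension of the span of its coordinates, $d$ is the minimum rank of a nonzero vector of $C$ and $A_i$ is the number of vectors of rank $i$ in $C$. If $C$ is dually AMRD, that is, if the matrix code obtained from $C$ by expanding each coordinate as a row in some basis of $\mathbb{F}_{q^m}$ over $\mathbb{F}_q$ is dually AMRD, then for all $r=1,\dots,n-d$ $$A_{d+r}=(-1)^rq^{\binom r2}{k\brack r}A_d+{n\brack k-r}\sum_{i=0}^{r-1}(-1)^iq^{\binom i2}{d+r\brack i}\left(q^{m(r-i)}-1\right).$$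 3. If $m\mid t$, then $$A_d\le\frac{{n\brack d+1}}{{n-d\brack 1}}(q^m-1),$$ and, if moreover $d+2\le n$, $$\frac{{n\brack d+2}}{q{n-d\brack 2}}(q^m-1)\left({d+2\brack 1}-q^m-1\right)\le A_d.$$ 4. Let $m\mid t$. If $A_{d+1}=0$, then $A_d=\frac{{n\brack d+1}}{{n-d\brack 1}}(q^m-1)$. If $d+2\le n$ and $A_{d+2}=0$, then $$A_d=\frac{{n\brack d+2}}{q{n-d\brack 2}}(q^m-1)\left({d+2\brack 1}-q^m-1\right).$$ -/

import Mathlib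

noncomputable section

namespace RankMetric

/-- The Gaussian binomial coefficient `[a, b]_q`, as a rational number
(it vanishes for `b > a`, because of the factor with index `a`). -/
def gaussBinom (q a b : ℕ) : ℚ :=
  ∏ i ∈ Finset.range b, ((q : ℚ) ^ a - (q : ℚ) ^ i) / ((q : ℚ) ^ b - (q : ℚ) ^ i)

section MatrixCodes

variable {F : Type*} [Field F] {n m : ℕ}

/-- The minimum rank of a nonzero matrix in the code. -/
def minDist (C : Submodule F (Matrix (Fin n) (Fin m) F)) : ℕ :=
  sInf {r | ∃ A ∈ C, A ≠ 0 ∧ A.rank = r}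

/-- `A_i(C)`, the number of matrices of rank `i` in the code. -/
def rankDist (C : Submodule F (Matrix (Fin n) (Fin m) F)) (i : ℕ) : ℕ :=
  Set.ncard {A : Matrix (Fin n) (Fin m) F | A ∈ C ∧ A.rank = i}

/-- The dual code with respect to the trace form `(B, A) ↦ Tr (B Aᵗ)`. -/
def dualCode (C : Submodule F (Matrix (Fin n) (Fin m) F)) :
    Submodule F (Matrix (Fin n) (Fin m) F) where
  carrier := {B | ∀ A ∈ C, (B * A.transpose).trace = 0}
  zero_mem' := by
    intro A _
    simp
  add_mem' := by
    intro B B' hB hB' A hA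
    rw [Matrix.add_mul, Matrix.trace_add, hB A hA, hB' A hA, add_zero]
  smul_mem' := by
    intro c B hB A hA
    rw [Matrix.smul_mul, Matrix.trace_smul, hB A hA, smul_zero]

/-- The rank defect `n - ⌈t / m⌉ + 1 - d` of a code with dimension `t` and minimum distance `d`. -/
def rankDefect (C : Submodule F (Matrix (Fin n) (Fin m) F)) : ℤ :=
  (n : ℤ) - ⌈(Module.finrank F C : ℚ) / (m : ℚ)⌉ + 1 - (minDist C : ℤ)

/-- A code is dually AMRD if both it and its dual have rank defect one. -/
def IsDuallyAMRD (C : Submodule F (Matrix (Fin n) (Fin m) F)) : Prop :=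
  rankDefect C = 1 ∧ rankDefect (dualCode C) = 1

end MatrixCodes

section VectorCodes

variable (F : Type*) {K : Type*} [Field F] [Field K] [Algebra F K] {n m : ℕ}

/-- The rank of a vector over the extension field `K`: the dimension over `F` of the span
of its coordinates. -/
def vecRank (v : Fin n → K) : ℕ :=
  Module.finrank F (Submodule.span F (Set.range v))

/-- The minimum rank of a nonzero vector in a `K`-linear code. -/
def vecMinDist (C : Submodule K (Fin n → K)) : ℕ :=
  sInf {r | ∃ v ∈ C, v ≠ 0 ∧ vecRank F v = r}

/-- The number of vectors of rank `i` in a `K`-linear code. -/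
def vecRankDist (C : Submodule K (Fin n → K)) (i : ℕ) : ℕ :=
  Set.ncard {v : Fin n → K | v ∈ C ∧ vecRank F v = i}

variable {F}

/-- The matrix whose `i`-th row holds the coordinates of `v i` in the basis `b`. -/
def coordMatrix (b : Module.Basis (Fin m) F K) :
    (Fin n → K) →ₗ[F] Matrix (Fin n) (Fin m) F where
  toFun v := Matrix.of fun i j => b.repr (v i) j
  map_add' v w := by
    ext i j
    simp
  map_smul' c v := by
    ext i j
    simp

/-- The `F`-linear matrix code associated to a `K`-linear code with respect to the basis `b`. -/
def assocCode (b : Module.Basis (Fin m) F K) (C : Submodule K (Fin n → K)) :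
    Submodule F (Matrix (Fin n) (Fin m) F) :=
  (C.restrictScalars F).map (coordMatrix b)

/-- A `K`-linear code is dually AMRD if its associated matrix code is
(with respect to some basis of `K` over `F`). -/
def IsDuallyAMRDVec (F : Type*) {K : Type*} [Field F] [Field K] [Algebra F K] {n : ℕ} (m : ℕ)
    (C : Submodule K (Fin n → K)) : Prop :=
  ∃ b : Module.Basis (Fin m) F K, IsDuallyAMRD (assocCode b C)

end VectorCodes

end RankMetric

end

/-! Let `d'` be the minimum distance of the dual code. For `c < d'` and a `c × n` matrix `f` of full
row rank, `A ↦ f * A` maps the code onto all `c × m` matrices (`range_mulLeftCode_eq_top`), so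
exactly `q ^ (t - m * c)` codewords satisfy `f * A = 0`. For a fixed `A`, the number of such `f`
depends only on the rank of `A`. Double counting the pairs `(A, f)` gives the Gaussian binomial
moments of the rank distribution (`sum_rankDist_mul_gaussBinom`).

With `c = n - (d + s)` the moments form a triangular system in `A_d, A_{d+1}, ...`, which
`gaussBinom_inversion` solves. The dually AMRD condition amounts to `d = n - ⌈t / m⌉` and `d' = ⌊t /
m⌋`. Hence the moments are known for `s ≥ 1` if `m ∣ t`, and for `s ≥ 2` otherwise; the missing ones
leave `A_d`, respectively `A_d` and `A_{d+1}`, as parameters. The bounds and equality cases express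
`A_{d+1}, A_{d+2} ≥ 0` in the formulas for `r = 1, 2`. -/

namespace RankMetric

/-! ### Gaussian binomial identities and inversion. -/

section GaussianBinomial

variable {q : ℕ}

/-- The product `∏ (q ^ a - q ^ i)` over `i < b`, the numerator of the Gaussian binomial. -/
def gaussNum (q a b : ℕ) : ℚ := ∏ i ∈ Finset.range b, ((q : ℚ) ^ a - (q : ℚ) ^ i)

/-- The product `∏ (q ^ i - 1)` over `1 ≤ i ≤ k`. -/
def qFactorial (q k : ℕ) : ℚ := ∏ i ∈ Finset.range k, ((q : ℚ) ^ (i + 1) - 1)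

theorem gaussBinom_eq_div (q a b : ℕ) : gaussBinom q a b = gaussNum q a b / gaussNum q b b :=
  Finset.prod_div_distrib ..

theorem gaussNum_succ (q a b : ℕ) :
    gaussNum q a (b + 1) = gaussNum q a b * ((q : ℚ) ^ a - (q : ℚ) ^ b) :=
  Finset.prod_range_succ ..

theorem gaussNum_succ_succ (q a b : ℕ) :
    gaussNum q (a + 1) (b + 1) = ((q : ℚ) ^ (a + 1) - 1) * (q : ℚ) ^ b * gaussNum q a b := by
  induction b with
  | zero => simp [gaussNum]
  | succ b ih =>
    rw [gaussNum_succ, ih, gaussNum_succ]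
    ring

theorem gaussNum_eq_zero {a b : ℕ} (h : a < b) : gaussNum q a b = 0 :=
  Finset.prod_eq_zero (Finset.mem_range.2 h) (sub_self _)

theorem one_lt_pow_succ (hq : 2 ≤ q) (k : ℕ) : (1 : ℚ) < (q : ℚ) ^ (k + 1) :=
  one_lt_pow₀ (by exact_mod_cast hq) (Nat.succ_ne_zero k)

theorem qFactorial_pos (hq : 2 ≤ q) (k : ℕ) : 0 < qFactorial q k :=
  Finset.prod_pos fun i _ => sub_pos.2 (one_lt_pow_succ hq i)

theorem qFactorial_succ (q k : ℕ) :
    qFactorial q (k + 1) = qFactorial q k * ((q : ℚ) ^ (k + 1) - 1) :=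
  Finset.prod_range_succ ..

/-- Each factor `q ^ (a + b) - q ^ i` is `q ^ i * (q ^ (a + b - i) - 1)`; the powers of `q` collect
to exponent `b.choose 2`. -/
theorem gaussNum_add_mul_qFactorial (q a b : ℕ) :
    gaussNum q (a + b) b * qFactorial q a = (q : ℚ) ^ (b.choose 2) * qFactorial q (a + b) := by
  induction b generalizing a with
  | zero => simp [gaussNum]
  | succ b ih =>
    have h := ih (a + 1)
    rw [qFactorial_succ] at h
    rw [gaussNum_succ, show a + (b + 1) = a + 1 + b by ring, Nat.choose_succ_succ' b 1,
      Nat.choose_one_right]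
    linear_combination (q : ℚ) ^ b * h

theorem gaussNum_self (q b : ℕ) : gaussNum q b b = (q : ℚ) ^ (b.choose 2) * qFactorial q b := by
  simpa [qFactorial] using gaussNum_add_mul_qFactorial q 0 b

theorem gaussNum_self_pos (hq : 2 ≤ q) (b : ℕ) : 0 < gaussNum q b b := by
  rw [gaussNum_self]
  have := qFactorial_pos hq b
  positivity

theorem gaussBinom_add (hq : 2 ≤ q) (a b : ℕ) :
    gaussBinom q (a + b) b = qFactorial q (a + b) / (qFactorial q a * qFactorial q b) := by
  have ha := (qFactorial_pos hq a).ne'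
  have hb := (qFactorial_pos hq b).ne'
  have hq0 : (q : ℚ) ^ (b.choose 2) ≠ 0 := by positivity
  rw [gaussBinom_eq_div, gaussNum_self, div_eq_div_iff (by positivity) (by positivity)]
  linear_combination qFactorial q b * gaussNum_add_mul_qFactorial q a b

theorem gaussBinom_pos (hq : 2 ≤ q) {a b : ℕ} (h : b ≤ a) : 0 < gaussBinom q a b := by
  obtain ⟨c, rfl⟩ := Nat.exists_eq_add_of_le' h
  have h1 := qFactorial_pos hq (c + b)
  have h2 := qFactorial_pos hq c
  have h3 := qFactorial_pos hq b
  rw [gaussBinom_add hq]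
  positivity

theorem gaussBinom_eq_zero {a b : ℕ} (h : a < b) : gaussBinom q a b = 0 := by
  rw [gaussBinom_eq_div, gaussNum_eq_zero h, zero_div]

theorem gaussBinom_symm (hq : 2 ≤ q) {a b : ℕ} (h : b ≤ a) :
    gaussBinom q a (a - b) = gaussBinom q a b := by
  obtain ⟨c, rfl⟩ := Nat.exists_eq_add_of_le' h
  rw [gaussBinom_add hq, Nat.add_sub_cancel, add_comm c b, gaussBinom_add hq, mul_comm]

theorem gaussBinom_zero_right (q a : ℕ) : gaussBinom q a 0 = 1 := by simp [gaussBinom]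

theorem gaussBinom_one_right (q a : ℕ) :
    gaussBinom q a 1 = ((q : ℚ) ^ a - 1) / ((q : ℚ) - 1) := by simp [gaussBinom]

theorem gaussBinom_succ_succ (hq : 2 ≤ q) (a b : ℕ) :
    gaussBinom q (a + 1) (b + 1) =
      gaussBinom q a b + (q : ℚ) ^ (b + 1) * gaussBinom q a (b + 1) := by
  have h1 := (gaussNum_self_pos hq b).ne'
  have h2 := (sub_pos.2 (one_lt_pow_succ hq b)).ne'
  have hq0 : (q : ℚ) ^ b ≠ 0 := by positivity
  rw [gaussBinom_eq_div, gaussBinom_eq_div, gaussBinom_eq_div, gaussNum_succ_succ q b b,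
    gaussNum_succ_succ, gaussNum_succ]
  field_simp
  ring

theorem gaussBinom_mul_gaussBinom_one (hq : 2 ≤ q) (a b : ℕ) :
    gaussBinom q (a + 1) 1 * gaussBinom q a b =
      gaussBinom q (a + 1) (b + 1) * gaussBinom q (b + 1) 1 := by
  have h1 := (gaussNum_self_pos hq b).ne'
  have h2 := (sub_pos.2 (one_lt_pow_succ hq b)).ne'
  have hq0 : (q : ℚ) ^ b ≠ 0 := by positivity
  rw [gaussBinom_one_right, gaussBinom_one_right, gaussBinom_eq_div, gaussBinom_eq_div,
    gaussNum_succ_succ, gaussNum_succ_succ]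
  field_simp

theorem gaussBinom_succ_one (hq : 2 ≤ q) (a : ℕ) :
    gaussBinom q (a + 1) 1 = gaussBinom q a 1 + (q : ℚ) ^ a := by
  have h : (q : ℚ) - 1 ≠ 0 := by simpa using (sub_pos.2 (one_lt_pow_succ hq 0)).ne'
  rw [gaussBinom_one_right, gaussBinom_one_right]
  field_simp
  ring

/-- Both sides are the q-trinomial coefficient with parts `a`, `b`, `j`. -/
theorem gaussBinom_mul_gaussBinom (hq : 2 ≤ q) (a b j : ℕ) :
    gaussBinom q (b + j) j * gaussBinom q (a + b + j) a =
      gaussBinom q (a + b + j) (a + j) * gaussBinom q (a + j) j := by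
  have ha := (qFactorial_pos hq a).ne'
  have hb := (qFactorial_pos hq b).ne'
  have hj := (qFactorial_pos hq j).ne'
  have hbj := (qFactorial_pos hq (b + j)).ne'
  have haj := (qFactorial_pos hq (a + j)).ne'
  have e1 := gaussBinom_add hq (b + j) a
  have e2 := gaussBinom_add hq b (a + j)
  rw [show b + j + a = a + b + j by ring] at e1
  rw [show b + (a + j) = a + b + j by ring] at e2
  rw [e1, e2, gaussBinom_add hq, gaussBinom_add hq]
  field_simp

/-- By the q-Pascal rule the alternating sum telescopes. At `j = a + 1` the right side vanishes,
which is the orthogonality behind the inversion. -/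
theorem sum_neg_one_pow_mul_gaussBinom_range (hq : 2 ≤ q) (a j : ℕ) :
    ∑ k ∈ Finset.range (j + 1), (-1) ^ k * (q : ℚ) ^ (k.choose 2) * gaussBinom q (a + 1) k =
      (-1) ^ j * (q : ℚ) ^ ((j + 1).choose 2) * gaussBinom q a j := by
  induction j with
  | zero => simp [gaussBinom]
  | succ j ih =>
    rw [Finset.sum_range_succ, ih, gaussBinom_succ_succ hq, Nat.choose_succ_succ' (j + 1) 1,
      Nat.choose_one_right]
    ring

theorem sum_neg_one_pow_mul_gaussBinom (hq : 2 ≤ q) (a : ℕ) :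
    ∑ k ∈ Finset.range (a + 1), (-1) ^ k * (q : ℚ) ^ (k.choose 2) * gaussBinom q a k =
      if a = 0 then 1 else 0 := by
  cases a with
  | zero => simp [gaussBinom]
  | succ a =>
    rw [sum_neg_one_pow_mul_gaussBinom_range hq, gaussBinom_eq_zero (Nat.lt_succ_self a)]
    simp

/-- Inversion of a triangular system with Gaussian binomial coefficients. -/
theorem gaussBinom_inversion (hq : 2 ≤ q) {N r : ℕ} (hr : r ≤ N) (a M : ℕ → ℚ)
    (hM : ∀ s ≤ r, ∑ i ∈ Finset.range (s + 1), a i * gaussBinom q (N - i) (s - i) = M s) :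
    a r = ∑ j ∈ Finset.range (r + 1),
      (-1) ^ j * (q : ℚ) ^ (j.choose 2) * gaussBinom q (N - r + j) j * M (r - j) := by
  -- After substituting the system for `M (r - j)`, the trinomial identity isolates the dependence
  -- on `j` in an alternating sum over `[r - i, j]`. Once the sums are exchanged, only `i = r`
  -- survives.
  have key : ∀ j ∈ Finset.range (r + 1),
      (-1) ^ j * (q : ℚ) ^ (j.choose 2) * gaussBinom q (N - r + j) j * M (r - j) =
        ∑ i ∈ Finset.range (r - j + 1), a i * gaussBinom q (N - i) (r - i) *
          ((-1) ^ j * (q : ℚ) ^ (j.choose 2) * gaussBinom q (r - i) j) := by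
    intro j hj
    rw [← hM _ (Nat.sub_le r j), Finset.mul_sum]
    refine Finset.sum_congr rfl fun i hi => ?_
    rw [Finset.mem_range] at hi hj
    have h := gaussBinom_mul_gaussBinom hq (r - j - i) (N - r) j
    rw [show r - j - i + (N - r) + j = N - i by omega, show r - j - i + j = r - i by omega] at h
    linear_combination (-1) ^ j * (q : ℚ) ^ (j.choose 2) * a i * h
  rw [Finset.sum_congr rfl key, Finset.sum_comm' (t' := Finset.range (r + 1))
    (s' := fun i => Finset.range (r - i + 1))
    (fun x y => by simp only [Finset.mem_range]; omega)]
  simp_rw [← Finset.mul_sum, sum_neg_one_pow_mul_gaussBinom hq]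
  rw [Finset.sum_eq_single_of_mem r (by simp)]
  · simp [gaussBinom_zero_right]
  · intro i hi hir
    rw [Finset.mem_range] at hi
    rw [if_neg (by omega), mul_zero]

end GaussianBinomial

end RankMetric

namespace RankMetric

/-! ### Moments of the rank distribution. -/

section Moments

open Module

variable {F : Type*} [Field F] {n m : ℕ}

theorem card_linearIndependent_eq_gaussNum [Fintype F] {V : Type*} [AddCommGroup V] [Module F V]
    [Finite V] (k : ℕ) :
    (Nat.card {s : Fin k → V // LinearIndependent F s} : ℚ) =
      gaussNum (Fintype.card F) (finrank F V) k := by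
  rcases le_or_gt k (finrank F V) with hk | hk
  · have hF : 1 ≤ Fintype.card F := Fintype.card_pos
    rw [card_linearIndependent hk, Nat.cast_prod, gaussNum, Finset.prod_range]
    refine Finset.prod_congr rfl fun i _ => ?_
    rw [Nat.cast_sub (Nat.pow_le_pow_right hF (i.2.le.trans hk)), Nat.cast_pow, Nat.cast_pow]
  · have : IsEmpty {s : Fin k → V // LinearIndependent F s} :=
      ⟨fun s => by simpa using (s.2.fintype_card_le_finrank.trans_lt hk).ne⟩
    rw [gaussNum_eq_zero hk, Nat.card_of_isEmpty, Nat.cast_zero]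

theorem finrank_ker_vecMulLinear (A : Matrix (Fin n) (Fin m) F) :
    finrank F (LinearMap.ker A.vecMulLinear) = n - A.rank := by
  have h := A.vecMulLinear.finrank_range_add_finrank_ker
  rw [finrank_fin_fun, range_vecMulLinear,
    ← Matrix.rank_eq_finrank_span_row] at h
  omega

/-- The rows of `f` are an independent tuple in the left kernel of `A`, of dimension `n - A.rank`.
-/
theorem card_linearIndependent_mul_eq_zero [Fintype F] (A : Matrix (Fin n) (Fin m) F) (c : ℕ) :
    (Nat.card {f : Matrix (Fin c) (Fin n) F // LinearIndependent F f.row ∧ f * A = 0} : ℚ) =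
      gaussNum (Fintype.card F) (n - A.rank) c := by
  rw [← finrank_ker_vecMulLinear A, ← card_linearIndependent_eq_gaussNum]
  have hmem (f : Matrix (Fin c) (Fin n) F) (h : f * A = 0) (i : Fin c) :
      f.row i ∈ LinearMap.ker A.vecMulLinear := by
    ext j
    exact congrFun (congrFun h i) j
  congr 1
  refine Nat.card_congr
    { toFun := fun f => ⟨fun i => ⟨f.1.row i, hmem f.1 f.2.2 i⟩,
        .of_comp (LinearMap.ker A.vecMulLinear).subtype f.2.1⟩
      invFun := fun s => ⟨Matrix.of fun i => (s.1 i : Fin n → F),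
        s.2.map' (LinearMap.ker A.vecMulLinear).subtype (Submodule.ker_subtype _), ?_⟩
      left_inv := fun _ => rfl
      right_inv := fun _ => rfl }
  ext i j
  exact congrFun (LinearMap.mem_ker.1 (s.1 i).2) j

/-- Left multiplication by `f` on a code. -/
def mulLeftCode (C : Submodule F (Matrix (Fin n) (Fin m) F)) {c : ℕ}
    (f : Matrix (Fin c) (Fin n) F) : C →ₗ[F] Matrix (Fin c) (Fin m) F :=
  (mulLeftLinearMap (Fin m) F f).comp C.subtype

theorem minDist_le_rank {C : Submodule F (Matrix (Fin n) (Fin m) F)}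
    {A : Matrix (Fin n) (Fin m) F} (hA : A ∈ C) (h0 : A ≠ 0) : minDist C ≤ A.rank :=
  Nat.sInf_le ⟨A, hA, h0, rfl⟩

theorem exists_dual_eq_trace (g : Dual F (Matrix (Fin n) (Fin m) F)) :
    ∃ X : Matrix (Fin n) (Fin m) F, ∀ Y, g Y = (X * Y.transpose).trace := by
  refine ⟨Matrix.of fun i j => g (Matrix.single i j 1), fun Y => ?_⟩
  conv_lhs => rw [Matrix.matrix_eq_sum_single Y]
  simp only [map_sum, Matrix.trace, Matrix.diag_apply, Matrix.mul_apply, Matrix.transpose_apply,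
    Matrix.of_apply]
  refine Finset.sum_congr rfl fun i _ => Finset.sum_congr rfl fun j _ => ?_
  rw [← mul_one (Y i j), ← smul_eq_mul, ← Matrix.smul_single, map_smul, smul_eq_mul, smul_eq_mul,
    mul_one, mul_comm]

/-- A nonzero functional `Y ↦ Tr (X Yᵗ)` vanishing on the image would put `fᵗ X` in the dual code.
It is nonzero because the rows of `f` are independent, yet its rank is at most `c`. -/
theorem range_mulLeftCode_eq_top (C : Submodule F (Matrix (Fin n) (Fin m) F)) {c : ℕ}
    (hc : c < minDist (dualCode C)) {f : Matrix (Fin c) (Fin n) F}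
    (hf : LinearIndependent F f.row) : LinearMap.range (mulLeftCode C f) = ⊤ := by
  by_contra hne
  obtain ⟨g, hg0, hg⟩ := Submodule.exists_le_ker_of_lt_top _ (lt_top_iff_ne_top.2 hne)
  obtain ⟨X, hX⟩ := exists_dual_eq_trace g
  have hmem : f.transpose * X ∈ dualCode C := by
    intro A hA
    have h : g (f * A) = 0 := hg ⟨⟨A, hA⟩, rfl⟩
    rw [hX, Matrix.transpose_mul, ← Matrix.mul_assoc, Matrix.trace_mul_comm] at h
    rwa [Matrix.mul_assoc]
  have hne0 : f.transpose * X ≠ 0 := by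
    intro h
    have hX0 : X = 0 := by
      have h' : X.transpose * f = 0 := by
        rw [← Matrix.transpose_transpose f, ← Matrix.transpose_mul, h, Matrix.transpose_zero]
      have hinj := Matrix.vecMul_injective_iff.2 hf
      ext i j
      exact congrFun (hinj (a₁ := X.transpose j) (a₂ := 0)
        ((congrFun h' j).trans (Matrix.zero_vecMul f).symm)) i
    exact hg0 (LinearMap.ext fun Y => by simp [hX, hX0])
  have h1 := minDist_le_rank hmem hne0
  have h2 := (Matrix.rank_mul_le_left f.transpose X).trans (Matrix.rank_le_width _)
  omega

theorem card_mul_eq_zero [Fintype F] (C : Submodule F (Matrix (Fin n) (Fin m) F)) {c : ℕ}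
    (hc : c < minDist (dualCode C)) {f : Matrix (Fin c) (Fin n) F}
    (hf : LinearIndependent F f.row) :
    Nat.card {A : C // f * A.1 = 0} * Fintype.card F ^ (m * c) =
      Fintype.card F ^ finrank F C := by
  have h := (mulLeftCode C f).finrank_range_add_finrank_ker
  rw [range_mulLeftCode_eq_top C hc hf, finrank_top, finrank_matrix, finrank_self, mul_one,
    Fintype.card_fin, Fintype.card_fin] at h
  have hk : Nat.card {A : C // f * A.1 = 0} =
      Fintype.card F ^ finrank F (LinearMap.ker (mulLeftCode C f)) := by
    rw [← Nat.card_eq_fintype_card, ← Module.natCard_eq_pow_finrank (K := F)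
      (V := LinearMap.ker (mulLeftCode C f))]
    rfl
  rw [hk, ← pow_add, ← h]
  ring

/-- The moment identity for the rank distribution, summed over the codewords. -/
theorem sum_gaussNum_codewords [Fintype F] (C : Submodule F (Matrix (Fin n) (Fin m) F)) {c : ℕ}
    (hc : c < minDist (dualCode C)) [Fintype C] :
    (∑ A : C, gaussNum (Fintype.card F) (n - A.1.rank) c) * (Fintype.card F : ℚ) ^ (m * c) =
      gaussNum (Fintype.card F) n c * (Fintype.card F : ℚ) ^ finrank F C := by
  -- Count the pairs `(A, f)` with `f * A = 0` in two ways.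
  classical
  have hdc := Finset.sum_card_bipartiteAbove_eq_sum_card_bipartiteBelow
    (s := (Finset.univ : Finset C))
    (t := Finset.univ.filter fun f : Matrix (Fin c) (Fin n) F => LinearIndependent F f.row)
    (fun A f => f * A.1 = 0)
  have h1 (A : C) : gaussNum (Fintype.card F) (n - A.1.rank) c =
      ((Finset.univ.filter fun f : Matrix (Fin c) (Fin n) F => LinearIndependent F f.row
        ).bipartiteAbove (fun (A : C) (f : Matrix (Fin c) (Fin n) F) => f * A.1 = 0) A).card := by
    rw [← card_linearIndependent_mul_eq_zero, Finset.bipartiteAbove, Finset.filter_filter,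
      Nat.card_eq_fintype_card, Fintype.card_subtype]
  have h2 : gaussNum (Fintype.card F) n c =
      ((Finset.univ.filter fun f : Matrix (Fin c) (Fin n) F =>
        LinearIndependent F f.row).card : ℚ) := by
    -- Taking `A = 0` counts all `f` of full row rank.
    have h := card_linearIndependent_mul_eq_zero (0 : Matrix (Fin n) (Fin m) F) c
    rw [Matrix.rank_zero, Nat.sub_zero] at h
    rw [← h, Nat.card_eq_fintype_card, Fintype.card_subtype]
    simp
  simp_rw [h1]
  rw [← Nat.cast_sum, hdc, h2]
  norm_cast
  rw [Finset.sum_mul, ← smul_eq_mul (Finset.card _), ← Finset.sum_const]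
  refine Finset.sum_congr rfl fun f hf => ?_
  rw [← card_mul_eq_zero C hc (Finset.mem_filter.1 hf).2, Finset.bipartiteBelow,
    Nat.card_eq_fintype_card, Fintype.card_subtype]

theorem sum_codewords_eq_sum_rankDist (C : Submodule F (Matrix (Fin n) (Fin m) F)) [Fintype C]
    (g : ℕ → ℚ) :
    ∑ A : C, g A.1.rank = ∑ i ∈ Finset.range (n + 1), (rankDist C i : ℚ) * g i := by
  classical
  rw [← Finset.sum_fiberwise_of_maps_to (s := Finset.univ) (t := Finset.range (n + 1))
    (g := fun A : C => A.1.rank)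
    (fun A _ => Finset.mem_range_succ_iff.2 (Matrix.rank_le_height A.1))]
  refine Finset.sum_congr rfl fun i _ => ?_
  have hcard : rankDist C i = (Finset.univ.filter fun A : C => A.1.rank = i).card := by
    rw [rankDist, ← Nat.card_coe_set_eq, ← Fintype.card_subtype, ← Nat.card_eq_fintype_card]
    exact Nat.card_congr (Equiv.subtypeSubtypeEquivSubtypeInter _ _).symm
  rw [hcard, ← nsmul_eq_mul, ← Finset.sum_const]
  exact Finset.sum_congr rfl fun A hA => by rw [(Finset.mem_filter.1 hA).2]

/-- Dividing by `gaussNum q c c` passes from independent tuples to the subspaces they span. -/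
theorem sum_rankDist_mul_gaussBinom [Fintype F] 
    (C : Submodule F (Matrix (Fin n) (Fin m) F)) {c : ℕ} (hc : c < minDist (dualCode C)) :
    (∑ i ∈ Finset.range (n + 1), (rankDist C i : ℚ) * gaussBinom (Fintype.card F) (n - i) c) *
        (Fintype.card F : ℚ) ^ (m * c) =
      gaussBinom (Fintype.card F) n c * (Fintype.card F : ℚ) ^ finrank F C := by
  classical
  have h := sum_gaussNum_codewords C hc
  rw [sum_codewords_eq_sum_rankDist C fun i => gaussNum (Fintype.card F) (n - i) c] at h
  simp_rw [gaussBinom_eq_div, ← mul_div_assoc, ← Finset.sum_div]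
  rw [div_mul_eq_mul_div, div_mul_eq_mul_div, h]

theorem rank_eq_zero_iff {A : Matrix (Fin n) (Fin m) F} : A.rank = 0 ↔ A = 0 := by
  rw [Matrix.rank, Submodule.finrank_eq_zero, LinearMap.range_eq_bot]
  refine ⟨fun h => Matrix.mulVec_injective (funext fun v => ?_), ?_⟩
  · rw [Matrix.zero_mulVec]
    exact LinearMap.congr_fun h v
  · rintro rfl
    exact Matrix.mulVecLin_zero

theorem rankDist_zero (C : Submodule F (Matrix (Fin n) (Fin m) F)) : rankDist C 0 = 1 := by
  rw [rankDist, Set.ncard_eq_one]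
  refine ⟨0, Set.ext fun A => ⟨fun h => rank_eq_zero_iff.1 h.2, ?_⟩⟩
  rintro rfl
  exact ⟨C.zero_mem, Matrix.rank_zero⟩

theorem rankDist_eq_zero {C : Submodule F (Matrix (Fin n) (Fin m) F)} {i : ℕ} (h0 : i ≠ 0)
    (hi : i < minDist C) : rankDist C i = 0 := by
  have : {A : Matrix (Fin n) (Fin m) F | A ∈ C ∧ A.rank = i} = ∅ := by
    refine Set.eq_empty_of_forall_notMem fun A hA => ?_
    have hA0 : A ≠ 0 := by
      rintro rfl
      exact h0 (hA.2.symm.trans Matrix.rank_zero)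
    exact (minDist_le_rank hA.1 hA0).not_gt (hA.2 ▸ hi)
  rw [rankDist, this, Set.ncard_empty]

theorem exists_rank_eq_minDist {C : Submodule F (Matrix (Fin n) (Fin m) F)} (hC : C ≠ ⊥) :
    ∃ A ∈ C, A ≠ 0 ∧ A.rank = minDist C := by
  obtain ⟨A, hA, h0⟩ := Submodule.exists_mem_ne_zero_of_ne_bot hC
  exact Nat.sInf_mem (s := {r | ∃ A ∈ C, A ≠ 0 ∧ A.rank = r}) ⟨_, A, hA, h0, rfl⟩

theorem minDist_pos {C : Submodule F (Matrix (Fin n) (Fin m) F)} (hC : C ≠ ⊥) :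
    0 < minDist C := by
  obtain ⟨A, -, h0, h⟩ := exists_rank_eq_minDist hC
  rw [← h, Nat.pos_iff_ne_zero]
  exact fun h' => h0 (rank_eq_zero_iff.1 h')

theorem minDist_le {C : Submodule F (Matrix (Fin n) (Fin m) F)} (hC : C ≠ ⊥) :
    minDist C ≤ n := by
  obtain ⟨A, -, -, h⟩ := exists_rank_eq_minDist hC
  exact h ▸ Matrix.rank_le_height A

/-- The moments of the rank distribution from the minimum distance on. -/
theorem sum_rankDist_minDist_add [Fintype F] (hq : 2 ≤ Fintype.card F)
    {C : Submodule F (Matrix (Fin n) (Fin m) F)} (hC : C ≠ ⊥) {s e : ℕ}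
    (hs : minDist C + s ≤ n) (hc : n - (minDist C + s) < minDist (dualCode C))
    (he : finrank F C = m * (n - (minDist C + s)) + e) :
    ∑ i ∈ Finset.range (s + 1), (rankDist C (minDist C + i) : ℚ) *
        gaussBinom (Fintype.card F) (n - minDist C - i) (s - i) =
      gaussBinom (Fintype.card F) n (minDist C + s) * ((Fintype.card F : ℚ) ^ e - 1) := by
  have h := sum_rankDist_mul_gaussBinom C hc
  rw [he, pow_add, mul_comm (_ ^ _) (_ ^ e), ← mul_assoc] at h
  replace h := mul_right_cancel₀ (by positivity) h
  -- Below the minimum distance only the zero matrix contributes; it is the source of the `- 1` on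
  -- the right.
  have hlow : ∑ i ∈ Finset.range (minDist C), (rankDist C i : ℚ) *
      gaussBinom (Fintype.card F) (n - i) (n - (minDist C + s)) =
        gaussBinom (Fintype.card F) n (n - (minDist C + s)) := by
    rw [Finset.sum_eq_single_of_mem 0 (Finset.mem_range.2 (minDist_pos hC)), rankDist_zero,
      Nat.cast_one, one_mul, Nat.sub_zero]
    intro i hi hi0
    rw [rankDist_eq_zero hi0 (Finset.mem_range.1 hi), Nat.cast_zero, zero_mul]
  -- For ranks above `d + s` the left kernel has dimension below `c = n - (d + s)`.
  have hhigh : ∑ i ∈ Finset.range (n - (minDist C + s)),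
      (rankDist C (minDist C + (s + 1) + i) : ℚ) *
      gaussBinom (Fintype.card F) (n - (minDist C + (s + 1) + i)) (n - (minDist C + s)) = 0 := by
    refine Finset.sum_eq_zero fun i hi => ?_
    rw [Finset.mem_range] at hi
    rw [gaussBinom_eq_zero (by omega), mul_zero]
  have hmid : ∀ i ∈ Finset.range (s + 1), (rankDist C (minDist C + i) : ℚ) *
      gaussBinom (Fintype.card F) (n - (minDist C + i)) (n - (minDist C + s)) =
        (rankDist C (minDist C + i) : ℚ) *
          gaussBinom (Fintype.card F) (n - minDist C - i) (s - i) := by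
    intro i hi
    rw [Finset.mem_range] at hi
    rw [← gaussBinom_symm hq (show s - i ≤ n - minDist C - i by omega),
      show n - minDist C - i - (s - i) = n - (minDist C + s) by omega, Nat.sub_sub]
  rw [show n + 1 = minDist C + (s + 1) + (n - (minDist C + s)) by omega,
    Finset.sum_range_add, Finset.sum_range_add, hlow, hhigh, Finset.sum_congr rfl hmid,
    gaussBinom_symm hq hs] at h
  linear_combination h

end Moments

end RankMetric

namespace RankMetric

/-! ### Dually AMRD matrix codes. -/

section DuallyAMRD

open Module

variable {F : Type*} [Field F] {n m : ℕ}

/-- The trace form as a map into the dual space. -/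
def traceDual (F : Type*) [Field F] (n m : ℕ) :
    Matrix (Fin n) (Fin m) F →ₗ[F] Dual F (Matrix (Fin n) (Fin m) F) :=
  LinearMap.mk₂ F (fun X Y => (X * Y.transpose).trace)
    (fun _ _ _ => by rw [Matrix.add_mul, Matrix.trace_add])
    (fun _ _ _ => by rw [Matrix.smul_mul, Matrix.trace_smul])
    (fun _ _ _ => by rw [Matrix.transpose_add, Matrix.mul_add, Matrix.trace_add])
    (fun _ _ _ => by rw [Matrix.transpose_smul, Matrix.mul_smul, Matrix.trace_smul])

theorem traceDual_bijective : Function.Bijective (traceDual F n m) := by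
  have hsurj : Function.Surjective (traceDual F n m) := fun g =>
    (exists_dual_eq_trace g).imp fun X hX => LinearMap.ext fun Y => (hX Y).symm
  exact ⟨(LinearMap.injective_iff_surjective_of_finrank_eq_finrank
    Subspace.dual_finrank_eq.symm).2 hsurj, hsurj⟩

/-- The trace form is nondegenerate, so it identifies the dual code with the annihilator of `C`. -/
theorem finrank_dualCode (C : Submodule F (Matrix (Fin n) (Fin m) F)) :
    finrank F C + finrank F (dualCode C) = n * m := by
  have hcomap : dualCode C =
      C.dualAnnihilator.comap (LinearEquiv.ofBijective _ traceDual_bijective).toLinearMap := by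
    ext B
    rw [Submodule.mem_comap, Submodule.mem_dualAnnihilator]
    rfl
  rw [hcomap, (LinearEquiv.ofSubmodule' _ _).finrank_eq,
    Subspace.finrank_add_finrank_dualAnnihilator_eq, finrank_matrix, finrank_self]
  simp

theorem IsDuallyAMRD.minDist_add {C : Submodule F (Matrix (Fin n) (Fin m) F)}
    (h : IsDuallyAMRD C) : (minDist C : ℤ) + ⌈(finrank F C : ℚ) / (m : ℚ)⌉ = n := by
  have := h.1
  rw [rankDefect] at this
  omega

/-- The dual has dimension `n * m - t`, and `⌈n - t / m⌉ = n - ⌊t / m⌋`. -/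
theorem IsDuallyAMRD.minDist_dualCode_add {C : Submodule F (Matrix (Fin n) (Fin m) F)}
    (h : IsDuallyAMRD C) (hm : 0 < m) :
    (minDist (dualCode C) : ℤ) = ⌊(finrank F C : ℚ) / (m : ℚ)⌋ := by
  have h1 := h.2
  have h2 : (finrank F (dualCode C) : ℚ) / m = (n : ℤ) + -((finrank F C : ℚ) / m) := by
    have h3 : (finrank F C : ℚ) + finrank F (dualCode C) = n * m := by
      exact_mod_cast finrank_dualCode C
    have hm' : (m : ℚ) ≠ 0 := by positivity
    field_simp
    push_cast
    linear_combination h3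
  rw [rankDefect, h2, Int.ceil_intCast_add, Int.ceil_neg] at h1
  omega

theorem IsDuallyAMRD.of_finrank_eq_mul {C : Submodule F (Matrix (Fin n) (Fin m) F)}
    (h : IsDuallyAMRD C) (hm : 0 < m) {k : ℕ} (hk : finrank F C = m * k) :
    minDist C + k = n ∧ minDist (dualCode C) = k := by
  have h1 := h.minDist_add
  have h2 := h.minDist_dualCode_add hm
  have hm' : (m : ℚ) ≠ 0 := by positivity
  rw [hk, Nat.cast_mul, mul_div_cancel_left₀ _ hm'] at h1 h2
  rw [Int.ceil_natCast] at h1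
  rw [Int.floor_natCast] at h2
  omega

theorem IsDuallyAMRD.of_finrank_eq_mul_add {C : Submodule F (Matrix (Fin n) (Fin m) F)}
    (h : IsDuallyAMRD C) {α β : ℕ} (hα : 1 ≤ α) (hαm : α < m)
    (hk : finrank F C = β * m + α) :
    minDist C + β + 1 = n ∧ minDist (dualCode C) = β := by
  have hm : 0 < m := by omega
  have h1 := h.minDist_add
  have h2 := h.minDist_dualCode_add hm
  have hm' : (0 : ℚ) < m := by positivity
  have hα' : (0 : ℚ) < α := by positivity
  have hαm' : (α : ℚ) < m := by exact_mod_cast hαm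
  have hceil : ⌈(finrank F C : ℚ) / m⌉ = (β : ℤ) + 1 := by
    rw [Int.ceil_eq_iff, hk, lt_div_iff₀ hm', div_le_iff₀ hm']
    push_cast
    constructor <;> nlinarith
  have hfloor : ⌊(finrank F C : ℚ) / m⌋ = (β : ℤ) := by
    rw [Int.floor_eq_iff, hk, le_div_iff₀ hm', div_lt_iff₀ hm']
    push_cast
    constructor <;> nlinarith
  omega

/-- This pulls the factor `[n, d + r]`, independent of `j`, out of the inverted sum. -/
theorem gaussBinom_mul_gaussBinom_sub {q : ℕ} (hq : 2 ≤ q) {n d r j : ℕ} (hr : r ≤ n - d)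
    (hd : d ≤ n) (hj : j ≤ r) :
    gaussBinom q (n - d - r + j) j * gaussBinom q n (d + (r - j)) =
      gaussBinom q n (d + r) * gaussBinom q (d + r) j := by
  have h := gaussBinom_mul_gaussBinom hq (d + (r - j)) (n - d - r) j
  rwa [show d + (r - j) + (n - d - r) + j = n by omega,
    show d + (r - j) + j = d + r by omega] at h

theorem pos_of_ne_bot (hnm : n ≤ m) {C : Submodule F (Matrix (Fin n) (Fin m) F)}
    (hC : C ≠ ⊥) : 0 < m :=
  ((minDist_pos hC).trans_le (minDist_le hC)).trans_le hnm

/-- The rank distribution of a dually AMRD code with `m ∣ t`. -/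
theorem IsDuallyAMRD.rankDist_of_dvd [Fintype F] {q : ℕ} (hq : Fintype.card F = q) (hnm : n ≤ m)
    {C : Submodule F (Matrix (Fin n) (Fin m) F)} (hC : C ≠ ⊥) (h : IsDuallyAMRD C)
    (hdvd : m ∣ finrank F C) {r : ℕ} (hr : r ≤ n - minDist C) :
    (rankDist C (minDist C + r) : ℚ) =
      (-1) ^ r * (q : ℚ) ^ (r.choose 2) *
        gaussBinom q (n - minDist C) r * (rankDist C (minDist C) : ℚ)
      + gaussBinom q n (minDist C + r) *
        ∑ i ∈ Finset.range r, (-1) ^ i * (q : ℚ) ^ (i.choose 2)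
          * gaussBinom q (minDist C + r) i * ((q : ℚ) ^ (m * (r - i)) - 1) := by
  have hq2 : 2 ≤ q := hq ▸ Fintype.one_lt_card
  obtain ⟨k, hk⟩ := hdvd
  obtain ⟨hd, hd'⟩ := h.of_finrank_eq_mul (pos_of_ne_bot hnm hC) hk
  -- Here `n - (d + s) < k` holds only for `s ≥ 1`, so the equation for `s = 0` is the tautology
  -- `A_d = A_d`.
  have hinv := gaussBinom_inversion hq2 hr (fun i => (rankDist C (minDist C + i) : ℚ))
    (fun s => if s = 0 then (rankDist C (minDist C) : ℚ) else
      gaussBinom q n (minDist C + s) * ((q : ℚ) ^ (m * s) - 1)) (by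
    intro s hs
    rcases Nat.eq_zero_or_pos s with rfl | hs0
    · simp [gaussBinom_zero_right]
    · rw [if_neg hs0.ne']
      subst hq
      refine sum_rankDist_minDist_add hq2 hC (by omega) (by omega) ?_
      rw [hk, ← mul_add]
      congr 1
      omega)
  rw [Finset.sum_range_succ, Nat.sub_self, if_pos rfl, Nat.sub_add_cancel hr] at hinv
  rw [hinv, Finset.mul_sum, add_comm]
  congr 1
  refine Finset.sum_congr rfl fun j hj => ?_
  rw [Finset.mem_range] at hj
  rw [if_neg (by omega)]
  linear_combination (-1) ^ j * (q : ℚ) ^ (j.choose 2) * ((q : ℚ) ^ (m * (r - j)) - 1) *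
    gaussBinom_mul_gaussBinom_sub hq2 hr (minDist_le hC) hj.le

/-- The rank distribution of a dually AMRD code with `m ∤ t`. -/
theorem IsDuallyAMRD.rankDist_of_finrank_eq_mul_add [Fintype F] {q : ℕ}
    (hq : Fintype.card F = q)
    {C : Submodule F (Matrix (Fin n) (Fin m) F)} (hC : C ≠ ⊥) (h : IsDuallyAMRD C)
    {α β : ℕ} (hα : 1 ≤ α) (hαm : α < m) (hk : finrank F C = β * m + α)
    {r : ℕ} (hr2 : 2 ≤ r) (hr : r ≤ n - minDist C) :
    (rankDist C (minDist C + r) : ℚ) =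
      (-1) ^ (r - 1) * (q : ℚ) ^ ((r - 1).choose 2) *
        (gaussBinom q (n - minDist C - 1) (r - 1) * (rankDist C (minDist C + 1) : ℚ)
          + gaussBinom q (n - minDist C) r * gaussBinom q (r - 1) 1
            * (rankDist C (minDist C) : ℚ))
      + gaussBinom q n (minDist C + r) *
        ∑ i ∈ Finset.range (r - 1), (-1) ^ i * (q : ℚ) ^ (i.choose 2)
          * gaussBinom q (minDist C + r) i * ((q : ℚ) ^ (α + m * (r - 1 - i)) - 1) := by
  have hq2 : 2 ≤ q := hq ▸ Fintype.one_lt_card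
  obtain ⟨hd, hd'⟩ := h.of_finrank_eq_mul_add hα hαm hk
  -- Since `n - d = β + 1` and the dual distance is `β`, the moments start at `s = 2`; the first two
  -- right sides just repeat the left sides.
  have hinv := gaussBinom_inversion hq2 hr (fun i => (rankDist C (minDist C + i) : ℚ))
    (fun s => if s = 0 then (rankDist C (minDist C) : ℚ) else if s = 1 then
      rankDist C (minDist C) * gaussBinom q (n - minDist C) 1 + rankDist C (minDist C + 1) else
      gaussBinom q n (minDist C + s) * ((q : ℚ) ^ (α + m * (s - 1)) - 1)) (by
    intro s hs
    rcases Nat.lt_or_ge s 2 with hs2 | hs2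
    · interval_cases s <;> simp [gaussBinom_zero_right, Finset.sum_range_succ]
    · rw [if_neg (by omega), if_neg (by omega)]
      subst hq
      refine sum_rankDist_minDist_add hq2 hC (by omega) (by omega) ?_
      obtain ⟨u, hu⟩ : ∃ u, β = u + (s - 1) := ⟨β - (s - 1), by omega⟩
      rw [hk, show n - (minDist C + s) = u by omega, hu]
      ring)
  obtain ⟨r, rfl⟩ := Nat.exists_eq_add_of_le' hr2
  obtain ⟨N, hN⟩ : ∃ N, n - minDist C = N + 1 := ⟨β, by omega⟩
  -- `A_d` enters through the last two terms of the inversion. Writing `[r + 2, 1] = [r + 1, 1] + q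
  -- ^ (r + 1)` cancels one of them and leaves the factor `[r + 1, 1]`.
  have hcoef := gaussBinom_mul_gaussBinom_one hq2 N (r + 1)
  rw [gaussBinom_succ_one hq2 (r + 1)] at hcoef
  rw [Finset.sum_range_succ, Finset.sum_range_succ, Nat.sub_self, if_pos rfl,
    Nat.sub_add_cancel hr, show r + 2 - (r + 1) = 1 by omega, if_neg one_ne_zero,
    if_pos rfl] at hinv
  have hsum : ∑ j ∈ Finset.range (r + 1), (-1) ^ j * (q : ℚ) ^ (j.choose 2) *
      gaussBinom q (n - minDist C - (r + 2) + j) j *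
        (if r + 2 - j = 0 then (rankDist C (minDist C) : ℚ) else if r + 2 - j = 1 then
          rankDist C (minDist C) * gaussBinom q (n - minDist C) 1 + rankDist C (minDist C + 1) else
          gaussBinom q n (minDist C + (r + 2 - j)) * ((q : ℚ) ^ (α + m * (r + 2 - j - 1)) - 1)) =
      gaussBinom q n (minDist C + (r + 2)) *
        ∑ i ∈ Finset.range (r + 1), (-1) ^ i * (q : ℚ) ^ (i.choose 2)
          * gaussBinom q (minDist C + (r + 2)) i * ((q : ℚ) ^ (α + m * (r + 1 - i)) - 1) := by
    rw [Finset.mul_sum]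
    refine Finset.sum_congr rfl fun j hj => ?_
    rw [Finset.mem_range] at hj
    rw [if_neg (by omega), if_neg (by omega), show r + 2 - j - 1 = r + 1 - j by omega]
    linear_combination (-1) ^ j * (q : ℚ) ^ (j.choose 2) *
      ((q : ℚ) ^ (α + m * (r + 1 - j)) - 1) *
      gaussBinom_mul_gaussBinom_sub hq2 hr (minDist_le hC) (by omega : j ≤ r + 2)
  rw [hinv, hsum, show n - minDist C - (r + 2) + (r + 1) = N by omega, hN, Nat.add_sub_cancel,
    show r + 2 - 1 = r + 1 by omega, Nat.choose_succ_succ' (r + 1) 1, Nat.choose_one_right]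
  linear_combination (-1) ^ (r + 1) * (q : ℚ) ^ ((r + 1).choose 2) *
    rankDist C (minDist C) * hcoef

/-- If `d = n`, then `d + t / m = n` forces `t = 0`. -/
theorem IsDuallyAMRD.minDist_lt_of_dvd (hnm : n ≤ m)
    {C : Submodule F (Matrix (Fin n) (Fin m) F)} (hC : C ≠ ⊥) (h : IsDuallyAMRD C)
    (hdvd : m ∣ finrank F C) : minDist C < n := by
  obtain ⟨k, hk⟩ := hdvd
  have hd := (h.of_finrank_eq_mul (pos_of_ne_bot hnm hC) hk).1
  have hpos : 0 < m * k := hk ▸ Nat.pos_of_ne_zero (mt Submodule.finrank_eq_zero.1 hC)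
  have := Nat.pos_of_mul_pos_left hpos
  omega

/-- The number of codewords of rank `d + 1` in a dually AMRD code with `m ∣ t`. -/
theorem IsDuallyAMRD.rankDist_add_one [Fintype F] {q : ℕ} (hq : Fintype.card F = q) (hnm : n ≤ m)
    {C : Submodule F (Matrix (Fin n) (Fin m) F)} (hC : C ≠ ⊥) (h : IsDuallyAMRD C)
    (hdvd : m ∣ finrank F C) :
    gaussBinom q n (minDist C + 1) / gaussBinom q (n - minDist C) 1 * ((q : ℚ) ^ m - 1) -
        rankDist C (minDist C) =
      rankDist C (minDist C + 1) / gaussBinom q (n - minDist C) 1 := by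
  have hq2 : 2 ≤ q := hq ▸ Fintype.one_lt_card
  have hlt := h.minDist_lt_of_dvd hnm hC hdvd
  have hr : 1 ≤ n - minDist C := by omega
  have hN := (gaussBinom_pos hq2 hr).ne'
  rw [h.rankDist_of_dvd hq hnm hC hdvd hr]
  simp only [Finset.sum_range_one, gaussBinom_zero_right, Nat.choose_zero_succ]
  field_simp
  simp
  ring

/-- The number of codewords of rank `d + 2` in a dually AMRD code with `m ∣ t`. -/
theorem IsDuallyAMRD.rankDist_add_two [Fintype F] {q : ℕ} (hq : Fintype.card F = q) (hnm : n ≤ m)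
    {C : Submodule F (Matrix (Fin n) (Fin m) F)} (hC : C ≠ ⊥) (h : IsDuallyAMRD C)
    (hdvd : m ∣ finrank F C) (hn : minDist C + 2 ≤ n) :
    (rankDist C (minDist C) : ℚ) -
        gaussBinom q n (minDist C + 2) / ((q : ℚ) * gaussBinom q (n - minDist C) 2)
          * ((q : ℚ) ^ m - 1) * (gaussBinom q (minDist C + 2) 1 - (q : ℚ) ^ m - 1) =
      rankDist C (minDist C + 2) / ((q : ℚ) * gaussBinom q (n - minDist C) 2) := by
  have hq2 : 2 ≤ q := hq ▸ Fintype.one_lt_card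
  have hr : 2 ≤ n - minDist C := by omega
  have hN := (gaussBinom_pos hq2 hr).ne'
  have hq0 : (q : ℚ) ≠ 0 := by positivity
  -- For `r = 2` the sum is `(q ^ (2m) - 1) - [d + 2, 1] * (q ^ m - 1)`, from which `q ^ m - 1`
  -- factors out.
  rw [h.rankDist_of_dvd hq hnm hC hdvd hr]
  simp only [Finset.sum_range_succ, Finset.sum_range_zero, gaussBinom_zero_right,
    Nat.choose_zero_succ, Nat.choose_self, show Nat.choose 1 2 = 0 from rfl, Nat.sub_zero,
    show 2 - 1 = 1 from rfl, mul_one, pow_mul']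
  field_simp
  ring

end DuallyAMRD

/-! ### Transfer from vector codes to matrix codes. -/

section VectorCodes

open Module

variable {F K : Type*} [Field F] [Field K] [Algebra F K] {n m : ℕ}

theorem coordMatrix_injective (b : Basis (Fin m) F K) :
    Function.Injective (coordMatrix (n := n) b) := by
  intro v w h
  ext i
  exact b.repr.injective (Finsupp.ext fun j => congrFun (congrFun h i) j)

/-- The coordinate isomorphism carries the span of the entries of `v` onto the row space. -/
theorem rank_coordMatrix (b : Basis (Fin m) F K) (v : Fin n → K) :
    (coordMatrix b v).rank = vecRank F v := by
  rw [Matrix.rank_eq_finrank_span_row, vecRank, ← LinearEquiv.finrank_map_eq b.equivFun,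
    Submodule.map_span, ← Set.range_comp]
  rfl

theorem minDist_assocCode (b : Basis (Fin m) F K) (C : Submodule K (Fin n → K)) :
    minDist (assocCode b C) = vecMinDist F C := by
  rw [minDist, vecMinDist]
  congr 1
  ext r
  constructor
  · rintro ⟨_, ⟨v, hv, rfl⟩, h0, hr⟩
    exact ⟨v, hv, fun h => h0 (by rw [h, map_zero]), (rank_coordMatrix b v).symm.trans hr⟩
  · rintro ⟨v, hv, h0, hr⟩
    exact ⟨_, ⟨v, hv, rfl⟩, (map_ne_zero_iff _ (coordMatrix_injective b)).2 h0,
      (rank_coordMatrix b v).trans hr⟩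

theorem rankDist_assocCode (b : Basis (Fin m) F K) (C : Submodule K (Fin n → K)) (i : ℕ) :
    rankDist (assocCode b C) i = vecRankDist F C i := by
  rw [rankDist, vecRankDist, ← Set.ncard_image_of_injective _ (coordMatrix_injective b)]
  congr 1
  ext A
  constructor
  · rintro ⟨⟨v, hv, rfl⟩, hr⟩
    exact ⟨v, ⟨hv, (rank_coordMatrix b v).symm.trans hr⟩, rfl⟩
  · rintro ⟨v, ⟨hv, hr⟩, rfl⟩
    exact ⟨⟨v, hv, rfl⟩, (rank_coordMatrix b v).trans hr⟩

theorem finrank_assocCode (b : Basis (Fin m) F K) (C : Submodule K (Fin n → K)) :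
    finrank F (assocCode b C) = m * finrank K C := by
  have : Module.Finite F K := .of_basis b
  rw [assocCode, (Submodule.equivMapOfInjective _ (coordMatrix_injective b) _).symm.finrank_eq,
    ← Fintype.card_fin m, ← finrank_eq_card_basis b]
  exact (finrank_mul_finrank F K C).symm

theorem assocCode_ne_bot (b : Basis (Fin m) F K) {C : Submodule K (Fin n → K)} (hC : C ≠ ⊥) :
    assocCode b C ≠ ⊥ := by
  obtain ⟨v, hv, h0⟩ := Submodule.exists_mem_ne_zero_of_ne_bot hC
  exact (Submodule.ne_bot_iff _).2
    ⟨_, ⟨v, hv, rfl⟩, (map_ne_zero_iff _ (coordMatrix_injective b)).2 h0⟩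

end VectorCodes

end RankMetric

/-! ### The main theorem. -/

theorem mainTheorem9 {F : Type*} [Field F] [Fintype F] (q n m : ℕ)
    (hq : Fintype.card F = q) (hnm : n ≤ m) :
    -- `F_q`-linear matrix codes
    (∀ (C : Submodule F (Matrix (Fin n) (Fin m) F)) (t d : ℕ),
      C ≠ ⊥ → C ≠ ⊤ → Module.finrank F C = t → RankMetric.minDist C = d →
      RankMetric.IsDuallyAMRD C →
      -- (1) the case `m ∤ t`
      (¬ m ∣ t → ∀ α β : ℕ, t = β * m + α → 1 ≤ α → α < m →
        ∀ r : ℕ, 2 ≤ r → r ≤ n - d →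
          (RankMetric.rankDist C (d + r) : ℚ) =
            (-1) ^ (r - 1) * (q : ℚ) ^ ((r - 1).choose 2) *
              (RankMetric.gaussBinom q (n - d - 1) (r - 1) * (RankMetric.rankDist C (d + 1) : ℚ)
                + RankMetric.gaussBinom q (n - d) r * RankMetric.gaussBinom q (r - 1) 1
                  * (RankMetric.rankDist C d : ℚ))
            + RankMetric.gaussBinom q n (d + r) *
              ∑ i ∈ Finset.range (r - 1), (-1) ^ i * (q : ℚ) ^ (i.choose 2)
                * RankMetric.gaussBinom q (d + r) i
                * ((q : ℚ) ^ (α + m * (r - 1 - i)) - 1)) ∧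
      -- (2) the case `m ∣ t`
      (m ∣ t → ∀ r : ℕ, 1 ≤ r → r ≤ n - d →
          (RankMetric.rankDist C (d + r) : ℚ) =
            (-1) ^ r * (q : ℚ) ^ (r.choose 2) *
              RankMetric.gaussBinom q (n - d) r * (RankMetric.rankDist C d : ℚ)
            + RankMetric.gaussBinom q n (d + r) *
              ∑ i ∈ Finset.range r, (-1) ^ i * (q : ℚ) ^ (i.choose 2)
                * RankMetric.gaussBinom q (d + r) i * ((q : ℚ) ^ (m * (r - i)) - 1)) ∧
      -- (3) bounds on `A_d`
      (m ∣ t →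
        (d + 2 ≤ n →
          RankMetric.gaussBinom q n (d + 2) / ((q : ℚ) * RankMetric.gaussBinom q (n - d) 2)
            * ((q : ℚ) ^ m - 1) * (RankMetric.gaussBinom q (d + 2) 1 - (q : ℚ) ^ m - 1)
            ≤ (RankMetric.rankDist C d : ℚ)) ∧
        (RankMetric.rankDist C d : ℚ) ≤
          RankMetric.gaussBinom q n (d + 1) / RankMetric.gaussBinom q (n - d) 1
            * ((q : ℚ) ^ m - 1)) ∧
      -- (4) the exact value of `A_d` when `A_{d+1} = 0` or `A_{d+2} = 0`
      (m ∣ t →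
        (RankMetric.rankDist C (d + 1) = 0 →
          (RankMetric.rankDist C d : ℚ) =
            RankMetric.gaussBinom q n (d + 1) / RankMetric.gaussBinom q (n - d) 1
              * ((q : ℚ) ^ m - 1)) ∧
        (d + 2 ≤ n → RankMetric.rankDist C (d + 2) = 0 →
          (RankMetric.rankDist C d : ℚ) =
            RankMetric.gaussBinom q n (d + 2) / ((q : ℚ) * RankMetric.gaussBinom q (n - d) 2)
              * ((q : ℚ) ^ m - 1)
              * (RankMetric.gaussBinom q (d + 2) 1 - (q : ℚ) ^ m - 1)))) ∧
    -- `F_{q^m}`-linear codes, the particular case in (2)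
    (∀ (K : Type*) [Field K] [Algebra F K], Module.finrank F K = m →
      ∀ (C : Submodule K (Fin n → K)) (k d : ℕ),
      C ≠ ⊥ → C ≠ ⊤ → Module.finrank K C = k → RankMetric.vecMinDist F C = d →
      RankMetric.IsDuallyAMRDVec F m C →
      ∀ r : ℕ, 1 ≤ r → r ≤ n - d →
        (RankMetric.vecRankDist F C (d + r) : ℚ) =
          (-1) ^ r * (q : ℚ) ^ (r.choose 2) *
            RankMetric.gaussBinom q k r * (RankMetric.vecRankDist F C d : ℚ)
          + RankMetric.gaussBinom q n (k - r) *
            ∑ i ∈ Finset.range r, (-1) ^ i * (q : ℚ) ^ (i.choose 2)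
              * RankMetric.gaussBinom q (d + r) i * ((q : ℚ) ^ (m * (r - i)) - 1)) := by
  have hq2 : 2 ≤ q := hq ▸ Fintype.one_lt_card
  refine ⟨?_, ?_⟩
  · rintro C t d hC - rfl rfl h
    refine ⟨fun _ α β hk hα hαm r hr2 hr =>
        h.rankDist_of_finrank_eq_mul_add hq hC hα hαm hk hr2 hr,
      fun hdvd r _ hr => h.rankDist_of_dvd hq hnm hC hdvd hr, fun hdvd => ⟨fun hn => ?_, ?_⟩,
      fun hdvd => ⟨fun h0 => ?_, fun hn h0 => ?_⟩⟩
    · have h1 := RankMetric.gaussBinom_pos hq2 (show 2 ≤ n - RankMetric.minDist C by omega)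
      rw [← sub_nonneg, h.rankDist_add_two hq hnm hC hdvd hn]
      positivity
    · have hlt := h.minDist_lt_of_dvd hnm hC hdvd
      have h1 := RankMetric.gaussBinom_pos hq2 (show 1 ≤ n - RankMetric.minDist C by omega)
      rw [← sub_nonneg, h.rankDist_add_one hq hnm hC hdvd]
      positivity
    · have h1 := h.rankDist_add_one hq hnm hC hdvd
      rw [h0, Nat.cast_zero, zero_div] at h1
      exact (sub_eq_zero.1 h1).symm
    · have h1 := h.rankDist_add_two hq hnm hC hdvd hn
      rw [h0, Nat.cast_zero, zero_div] at h1
      exact sub_eq_zero.1 h1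
  · rintro K _ _ - C k d hC - rfl rfl ⟨b, h⟩ r - hr
    have hC' := RankMetric.assocCode_ne_bot b hC
    have hk := RankMetric.finrank_assocCode b C
    have hd := (h.of_finrank_eq_mul (RankMetric.pos_of_ne_bot hnm hC') hk).1
    have hmain := h.rankDist_of_dvd (r := r) hq hnm hC' ⟨_, hk⟩
    simp only [RankMetric.minDist_assocCode, RankMetric.rankDist_assocCode] at hmain hd
    rw [show n - RankMetric.vecMinDist F C = Module.finrank K C by omega] at hmain hr
    -- Since `d + k = n`, symmetry gives `[n, k - r] = [n, d + r]`.
    rw [← RankMetric.gaussBinom_symm hq2 (show Module.finrank K C - r ≤ n by omega),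
      show n - (Module.finrank K C - r) = RankMetric.vecMinDist F C + r by omega]
    exact hmain hr
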